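/- Let $n$ be a positive integer and $k$ a non-negative integer, and put $$D_{n,k}=\det_{0\le i,j\le n-1}\left(\sum_{l=-k}^{k+1}\binom{2i+2j+2}{i+j+l+1}\right),$$ where $\binom{N}{m}=0$ if $m<0$ or $m>N$. Then, with $n_1$ denoting a non-negative integer, $$D_{n,k}=\begin{cases} (-1)^{n_1\binom{k+1}{2}}(2n_1+1), & \text{if } n=(k+1)n_1 \text{ and } k \text{ is even},\\ (-1)^{n_1\binom{k+1}{2}}, & \text{if } n=(k+1)n_1 \text{ and } k \text{ is odd},\\ (-1)^{n_1\binom{k+1}{2}}(4n_1+4), & \text{if } k\ge 1 \text{ and } n=(k+1)n_1+1,\\ (-1)^{(n_1+1)\binom{k+1}{2}+k}(4n_1+4), & \text{if } k\ge 1 \text{ and } n=(k+1)n_1+k,\\ 0, & \text{if } n\not\equiv 0,1,k \pmod{k+1}. \end{cases}$$ (For $k=1$ the third and fourth cases coincide and give the same value.) -/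

import Mathlib

/-- The binomial coefficient with a natural upper index and an arbitrary integer lower index `m`;
it is zero when `m < 0` (and, as for `Nat.choose`, when `m > N`). -/
def intBinom (N : ℕ) (m : ℤ) : ℤ :=
  if 0 ≤ m then (N.choose m.toNat : ℤ) else 0

/-- The `n × n` matrix, with rows and columns numbered from `0` to `n - 1`, whose `(i, j)` entry is
the sum of `binom (2i + 2j + 2) (i + j + l + 1)` over the integers `l` with `-k ≤ l ≤ k + 1`. -/
noncomputable def binomSumHankel (k n : ℕ) : Matrix (Fin n) (Fin n) ℤ :=
  Matrix.of fun i j =>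
    ∑ l ∈ Finset.Icc (-(k : ℤ)) ((k : ℤ) + 1),
      intBinom (2 * (i : ℕ) + 2 * (j : ℕ) + 2) (((i : ℕ) : ℤ) + ((j : ℕ) : ℤ) + l + 1)

/-!
Since `x + 2 + x⁻¹ = (1 + x) ^ 2 / x`, the entries are the moments `F (X ^ (i + j + 1))` of the
functional `F` sending `p` to the constant term of `(x ^ (-N) + ⋯ + x ^ (N - 1)) * p (x + 2 + x⁻¹)`,
where `N = k + 1`. A polynomial of degree `n` which is orthogonal to more powers of `X` than its
degree requires brings the Hankel matrix of size `n + g` to block triangular form, which relates the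
determinants of sizes `n + g` and `n`.

Such polynomials come from the Chebyshev polynomials:
`U a = (x ^ (N a) - x ^ (-N a)) / (x ^ N - x ^ (-N))` is a polynomial of degree `N (a - 1)` in
`x + 2 + x⁻¹`, and multiplying the sum `x ^ (-N) + ⋯ + x ^ (N - 1)` by it replaces `N` by `N a`. As
the binomial coefficients with upper index `2 m` add up to `4 ^ m`, this gives
`F (X ^ m * U a) = 4 ^ m` for `m < N a`, and `4 ^ m - 1` for `m = N a`. Hence `X (X - 4) U (q + 1)`
produces the long gap of zero determinants between the sizes `N q + 1` and `N q + k`, and two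
combinations of `X U (q + 1)`, `U (q + 1)` and a neighbour of `U (q + 1)` lead from size `N q` to
`N q + 1` and from `N q + k` to `N (q + 1)`.
-/

section HankelDet

open Polynomial Matrix

variable {R : Type*} [CommRing R]

/-- The `n × n` Hankel determinant `det (μ (i + j))` of a sequence `μ`, rows and columns being
numbered from `0`. -/
def hankelDet (μ : ℕ → R) (n : ℕ) : R :=
  (of fun i j : Fin n => μ (i + j)).det

lemma det_linearMap_apply_of_natDegree_le {n : ℕ} (ψ : Fin n → R[X] →ₗ[R] R) (p : Fin n → R[X])
    (hp : ∀ j, (p j).natDegree ≤ j) :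
    (of fun i j => ψ i (p j)).det
      = (∏ j, (p j).coeff j) * (of fun i j : Fin n => ψ i (X ^ (j : ℕ))).det := by
  have hfactor : (of fun i j => ψ i (p j))
      = (of fun i j : Fin n => ψ i (X ^ (j : ℕ))) * of fun i j : Fin n => (p j).coeff i := by
    ext i j
    rw [of_apply, mul_apply, (p j).as_sum_range' n ((hp j).trans_lt j.2), map_sum,
      Finset.sum_range]
    refine Finset.sum_congr rfl fun t _ => ?_
    rw [← C_mul_X_pow_eq_monomial, ← smul_eq_C_mul, map_smul, smul_eq_mul, mul_comm, of_apply,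
      of_apply]
  have htriangular : (of fun i j : Fin n => (p j).coeff i).IsUpperTriangular :=
    fun i j hij => coeff_eq_zero_of_natDegree_lt ((hp j).trans_lt hij)
  rw [hfactor, det_mul, det_of_isUpperTriangular htriangular, mul_comm]
  rfl

lemma hankelDet_of_forall_lt_eq_zero (μ : ℕ → R) (g : ℕ) (hμ : ∀ m, m + 1 < g → μ m = 0) :
    hankelDet μ g = (-1) ^ g.choose 2 * μ (g - 1) ^ g := by
  induction g generalizing μ with
  | zero => simp [hankelDet]
  | succ g ih =>
    have hexpand : hankelDet μ (g + 1) = (-1) ^ g * μ g * hankelDet (fun m => μ (m + 1)) g := by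
      rw [hankelDet, det_succ_row_zero, Finset.sum_eq_single (Fin.last g)]
      · simp [hankelDet, submatrix, add_right_comm]
      · intro j _ hj
        have hjg : (j : ℕ) < g := Fin.val_lt_last hj
        simp [hμ j (by omega)]
      · simp
    rw [hexpand, ih _ fun m hm => hμ _ (by omega)]
    cases g with
    | zero => simp
    | succ g =>
      rw [Nat.choose_succ_succ' (g + 1) 1, Nat.choose_one_right, pow_add]
      simp only [Nat.add_sub_cancel]
      ring

/-- If `p` has degree `n` and `φ` annihilates `p, X p, …, X ^ (n + g - 2) p`, then the Gram matrix
of `φ` in the basis `1, …, X ^ (n - 1), p, X p, …, X ^ (g - 1) p` is block triangular. -/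
lemma coeff_pow_mul_hankelDet_add (φ : R[X] →ₗ[R] R) (p : R[X]) {n g : ℕ} (hp : p.natDegree ≤ n)
    (hφ : ∀ m, m + 1 < n + g → φ (X ^ m * p) = 0) :
    p.coeff n ^ g * hankelDet (fun m => φ (X ^ m)) (n + g)
      = (-1) ^ g.choose 2 * φ (X ^ (n + g - 1) * p) ^ g * hankelDet (fun m => φ (X ^ m)) n := by
  let r : Fin (n + g) → R[X] := Fin.append (fun j => X ^ (j : ℕ)) fun j => X ^ (j : ℕ) * p
  have hr (j) : (r j).natDegree ≤ j := by
    refine Fin.addCases (fun j => ?_) (fun j => ?_) j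
    · simpa [r] using natDegree_X_pow_le (j : ℕ)
    · simpa [r, add_comm] using natDegree_mul_le_of_le (natDegree_X_pow_le (j : ℕ)) hp
  have hcoeff : ∏ j, (r j).coeff j = p.coeff n ^ g := by
    simp [r, Fin.prod_univ_add, coeff_X_pow_mul', add_comm n]
  have hblocks : (of fun i j : Fin (n + g) => φ (X ^ (i : ℕ) * r j)).submatrix
        finSumFinEquiv finSumFinEquiv
      = fromBlocks (of fun i j : Fin n => φ (X ^ (i + j : ℕ))) 0
          (of fun (i : Fin g) (j : Fin n) => φ (X ^ (n + i + j : ℕ)))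
          (of fun i j : Fin g => φ (X ^ (n + (i + j) : ℕ) * p)) := by
    ext (i | i) (j | j)
    · simp [r, pow_add]
    · simpa [r, pow_add, mul_assoc] using hφ (i + j) (by omega)
    · simp [r, pow_add]
    · simp [r, pow_add, mul_assoc]
  have hcorner : (of fun i j : Fin g => φ (X ^ (n + (i + j) : ℕ) * p)).det
      = (-1) ^ g.choose 2 * φ (X ^ (n + g - 1) * p) ^ g := by
    obtain rfl | hg := g.eq_zero_or_pos
    · simp
    · rw [Nat.add_sub_assoc hg]
      exact hankelDet_of_forall_lt_eq_zero (fun m => φ (X ^ (n + m) * p)) g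
        fun m hm => hφ _ (by omega)
  have hbasis := det_linearMap_apply_of_natDegree_le
    (fun i : Fin (n + g) => φ ∘ₗ LinearMap.mulLeft R (X ^ (i : ℕ))) r hr
  simp only [LinearMap.comp_apply, LinearMap.mulLeft_apply, ← pow_add, hcoeff] at hbasis
  rw [hankelDet, ← hbasis, ← det_submatrix_equiv_self finSumFinEquiv, hblocks,
    det_fromBlocks_zero₁₂, hcorner, mul_comm]
  rfl

end HankelDet

section CentralSum

open Polynomial LaurentPolynomial

/-- The substitution `X ↦ x + 2 + x⁻¹ = (1 + x) ^ 2 / x`, under which the coefficients of the image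
of `X ^ m` are the binomial coefficients with upper index `2 * m`. -/
noncomputable def binomialSubst : ℤ[X] →ₐ[ℤ] ℤ[T;T⁻¹] :=
  aeval (T 1 + 2 + T (-1))

/-- The Laurent polynomial `x ^ (-M) + ⋯ + x ^ (M - 1)`. -/
noncomputable def centralSum (M : ℕ) : ℤ[T;T⁻¹] :=
  ∑ l ∈ Finset.Ico (-(M : ℤ)) M, T l

/-- The linear functional sending `p` to the constant term of
`(x ^ (-M) + ⋯ + x ^ (M - 1)) * p (x + 2 + x⁻¹)`. -/
noncomputable def centralFunctional (M : ℕ) : ℤ[X] →ₗ[ℤ] ℤ :=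
  Finsupp.lapply 0 ∘ₗ (AddMonoidAlgebra.coeffLinearEquiv ℤ).toLinearMap ∘ₗ
    LinearMap.mulLeft ℤ (centralSum M) ∘ₗ binomialSubst.toLinearMap

lemma centralFunctional_apply (M : ℕ) (p : ℤ[X]) :
    centralFunctional M p = (centralSum M * binomialSubst p).coeff 0 := rfl

lemma binomialSubst_X : binomialSubst X = T 1 + 2 + T (-1) := aeval_X _

lemma coeff_binomialSubst_X_pow (m : ℕ) (l : ℤ) :
    (binomialSubst (X ^ m)).coeff l = intBinom (2 * m) (m + l) := by
  have hfactor : binomialSubst (X ^ m) = toLaurent ((1 + X) ^ (2 * m)) * T (-m) := by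
    have hT : T 1 * T (-1) = (1 : ℤ[T;T⁻¹]) := by rw [← T_add, add_neg_cancel, T_zero]
    have hX : binomialSubst X = (1 + T 1) ^ 2 * T (-1) := by
      rw [binomialSubst_X]
      linear_combination (-T 1 - 2) * hT
    rw [map_pow, hX, mul_pow, ← pow_mul, T_pow, mul_neg_one, map_pow, map_add, map_one,
      toLaurent_X]
  have hshift : (binomialSubst (X ^ m)).coeff l
      = (toLaurent ((1 + X : ℤ[X]) ^ (2 * m))).coeff (m + l) := by
    rw [hfactor, T, AddMonoidAlgebra.coeff_mul_single_apply, mul_one, neg_neg, add_comm l]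
  rw [hshift, coeff_toLaurent, intBinom]
  split_ifs with h
  · obtain ⟨j, hj⟩ := Int.eq_ofNat_of_zero_le h
    rw [hj, Int.toNat_natCast]
    exact (Finsupp.mapDomain_apply Nat.castEmbedding.injective _ _).trans
      (coeff_one_add_X_pow ℤ _ _)
  · exact Finsupp.mapDomain_of_notMem_range _ _ fun ⟨j, hj⟩ =>
      h ((Int.natCast_nonneg j).trans_eq hj)

lemma centralFunctional_X_pow_eq_sum (M m : ℕ) :
    centralFunctional M (X ^ m)
      = ∑ l ∈ Finset.Icc (1 - (M : ℤ)) M, intBinom (2 * m) (m + l) := by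
  rw [centralFunctional_apply, centralSum, Finset.sum_mul, AddMonoidAlgebra.coeff_sum,
    Finset.sum_apply']
  refine Finset.sum_equiv (Equiv.neg ℤ) (fun l => ?_) fun l _ => ?_
  · simp only [Finset.mem_Ico, Equiv.neg_apply, Finset.mem_Icc]
    omega
  · rw [T, AddMonoidAlgebra.coeff_single_mul_apply, one_mul, add_zero, coeff_binomialSubst_X_pow,
      Equiv.neg_apply]

lemma sum_intBinom {M m : ℕ} (hm : m ≤ M) :
    ∑ l ∈ Finset.Icc (-(M : ℤ)) M, intBinom (2 * m) (m + l) = 4 ^ m := by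
  have hrow : ∑ j ∈ Finset.range (2 * m + 1), ((2 * m).choose j : ℤ) = 4 ^ m := by
    rw [← Nat.cast_sum, Nat.sum_range_choose, pow_mul]
    norm_num
  rw [← hrow]
  symm
  refine Finset.sum_of_injOn (fun j => (j : ℤ) - m) (fun i _ j _ h => by simpa using h)
    (fun j hj => ?_) (fun l _ hl => ?_) fun j _ => ?_
  · simp only [Finset.coe_range, Set.mem_Iio, Finset.coe_Icc, Set.mem_Icc] at hj ⊢
    omega
  · rw [intBinom]
    split_ifs with h
    · rw [Nat.choose_eq_zero_of_lt, Nat.cast_zero]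
      by_contra! hle
      exact hl ⟨(m + l).toNat, Finset.mem_coe.2 (Finset.mem_range.2 (by omega)), by simp [h]⟩
    · rfl
  · simp [intBinom]

lemma centralFunctional_X_pow {M m : ℕ} (hm : m ≤ M) :
    centralFunctional M (X ^ m) = 4 ^ m - if m = M then 1 else 0 := by
  have hfirst : intBinom (2 * m) (m + -M) = if m = M then 1 else 0 := by
    rw [intBinom]
    split_ifs with h1 h2 h2
    · simp [h2]
    · omega
    · omega
    · rfl
  have hinsert : Finset.Icc (-(M : ℤ)) M = insert (-(M : ℤ)) (Finset.Icc (1 - (M : ℤ)) M) := by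
    ext l
    simp only [Finset.mem_Icc, Finset.mem_insert]
    omega
  rw [centralFunctional_X_pow_eq_sum, ← sum_intBinom hm, hinsert,
    Finset.sum_insert (by simp), hfirst, add_sub_cancel_left]

lemma centralSum_zero : centralSum 0 = 0 := by simp [centralSum]

lemma centralSum_succ (M : ℕ) :
    centralSum (M + 1) = centralSum M + T M + T (-(M + 1)) := by
  have hIco : Finset.Ico (-((M + 1 : ℕ) : ℤ)) ((M + 1 : ℕ) : ℤ)
      = insert (-((M : ℤ) + 1)) (insert (M : ℤ) (Finset.Ico (-(M : ℤ)) M)) := by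
    ext l
    simp only [Finset.mem_Ico, Finset.mem_insert]
    omega
  rw [centralSum, hIco, Finset.sum_insert (by simp), Finset.sum_insert (by simp), centralSum]
  ring

lemma centralSum_mul_T_one_sub_one (M : ℕ) : centralSum M * (T 1 - 1) = T M - T (-M) := by
  induction M with
  | zero => simp [centralSum_zero]
  | succ M ih =>
    rw [centralSum_succ, add_mul, add_mul, ih]
    simp only [mul_sub, mul_one, ← T_add]
    push_cast
    ring_nf

lemma T_one_sub_one_ne_zero : (T 1 - 1 : ℤ[T;T⁻¹]) ≠ 0 := by
  rw [← T_zero, sub_ne_zero]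
  exact fun h => one_ne_zero ((AddMonoidAlgebra.single_left_inj one_ne_zero).1 h)

lemma centralSum_add_mul (M N : ℕ) :
    centralSum (M + N) * (T N + T (-N)) = centralSum (M + 2 * N) + centralSum M := by
  apply mul_right_cancel₀ T_one_sub_one_ne_zero
  rw [add_mul, mul_right_comm, centralSum_mul_T_one_sub_one, centralSum_mul_T_one_sub_one,
    centralSum_mul_T_one_sub_one]
  simp only [sub_mul, mul_add, ← T_add]
  push_cast
  ring_nf

end CentralSum

section ChebBlock

open Polynomial LaurentPolynomial

/-- The Chebyshev polynomials `S (a - 1)` of the second kind evaluated at `C N`, in the variable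
`X - 2`: under `X ↦ x + 2 + x⁻¹` it becomes `(x ^ (N a) - x ^ (-N a)) / (x ^ N - x ^ (-N))`. -/
noncomputable def chebBlock (N a : ℕ) : ℤ[X] :=
  (Chebyshev.S ℤ (a - 1)).comp ((Chebyshev.C ℤ N).comp (X - 2))

lemma chebBlock_zero (N : ℕ) : chebBlock N 0 = 0 := by simp [chebBlock]

lemma chebBlock_one (N : ℕ) : chebBlock N 1 = 1 := by simp [chebBlock]

lemma chebBlock_add_two (N a : ℕ) :
    chebBlock N (a + 2)
      = (Chebyshev.C ℤ N).comp (X - 2) * chebBlock N (a + 1) - chebBlock N a := by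
  have hS : Chebyshev.S ℤ ((a + 2 : ℕ) - 1)
      = X * Chebyshev.S ℤ ((a + 1 : ℕ) - 1) - Chebyshev.S ℤ (a - 1) := by
    have := Chebyshev.S_add_two ℤ ((a : ℤ) - 1)
    push_cast
    ring_nf at this ⊢
    exact this
  rw [chebBlock, hS, sub_comp, mul_comp, X_comp]
  rfl

lemma binomialSubst_C_comp (N : ℕ) :
    binomialSubst ((Chebyshev.C ℤ N).comp (X - 2)) = T N + T (-N) := by
  have hX : binomialSubst (X - 2) = T 1 + T (-1) := by
    rw [map_sub, binomialSubst_X, map_ofNat]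
    ring
  induction N using Nat.twoStepInduction with
  | zero => simp [one_add_one_eq_two, map_ofNat]
  | one => simpa using hX
  | more N ih1 ih2 =>
    push_cast at ih2 ⊢
    rw [Chebyshev.C_add_two, sub_comp, mul_comp, X_comp, map_sub, map_mul, ih1, ih2, hX]
    simp only [add_mul, mul_add, ← T_add]
    ring_nf

lemma centralSum_mul_binomialSubst_chebBlock (N a : ℕ) :
    centralSum N * binomialSubst (chebBlock N a) = centralSum (N * a) := by
  induction a using Nat.twoStepInduction with
  | zero => simp [chebBlock_zero, centralSum_zero]
  | one => simp [chebBlock_one]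
  | more a ih1 ih2 =>
    rw [chebBlock_add_two, map_sub, map_mul, binomialSubst_C_comp, mul_sub, mul_left_comm, ih1,
      ih2, mul_comm, mul_add_one, centralSum_add_mul, add_sub_cancel_right]
    ring_nf

lemma centralFunctional_X_pow_mul_chebBlock {N a m : ℕ} (hm : m ≤ N * a) :
    centralFunctional N (X ^ m * chebBlock N a) = 4 ^ m - if m = N * a then 1 else 0 := by
  rw [centralFunctional_apply, mul_comm (X ^ m), map_mul, ← mul_assoc,
    centralSum_mul_binomialSubst_chebBlock, ← centralFunctional_apply, centralFunctional_X_pow hm]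

lemma neg_one_pow_sq (k : ℕ) : ((-1 : ℤ) ^ k) ^ 2 = 1 := by
  rw [← pow_mul, mul_comm, pow_mul, neg_one_sq, one_pow]

lemma coeff_zero_chebBlock (N a : ℕ) : (chebBlock N a).coeff 0 = (-1) ^ (N * (a + 1)) * a := by
  have hC : ((Chebyshev.C ℤ N).comp (X - 2)).coeff 0 = 2 * (-1) ^ N := by
    rw [coeff_zero_eq_eval_zero, eval_comp]
    simp [Chebyshev.C_eval_neg_two]
  induction a using Nat.twoStepInduction with
  | zero => simp [chebBlock_zero]
  | one => simp [chebBlock_one]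
  | more a ih1 ih2 =>
    rw [chebBlock_add_two, coeff_sub, mul_coeff_zero, hC, ih1, ih2]
    simp only [pow_mul, pow_succ]
    push_cast
    linear_combination ((-1 : ℤ) ^ N) ^ (a + 1) * a * neg_one_pow_sq N

end ChebBlock

section ChebyshevDegree

open Polynomial

variable (R : Type*) [CommRing R] [IsDomain R] [NeZero (2 : R)]

lemma natDegree_chebyshev_S (a : ℕ) : (Chebyshev.S R a).natDegree = a := by
  have h := congrArg natDegree (Chebyshev.S_comp_two_mul_X R a)
  rwa [natDegree_comp, ← C_ofNat, natDegree_C_mul_X _ two_ne_zero, mul_one,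
    Chebyshev.natDegree_U_natCast] at h

lemma monic_chebyshev_S (a : ℕ) : (Chebyshev.S R a).Monic := by
  have h := congrArg leadingCoeff (Chebyshev.S_comp_two_mul_X R a)
  rw [← C_ofNat, leadingCoeff_comp (by simp [two_ne_zero]), leadingCoeff_mul_X, leadingCoeff_C,
    natDegree_chebyshev_S, Chebyshev.leadingCoeff_U_natCast] at h
  exact mul_right_cancel₀ (pow_ne_zero a two_ne_zero) (h.trans (one_mul _).symm)

lemma natDegree_chebyshev_C (N : ℕ) : (Chebyshev.C R N).natDegree = N := by
  have h := congrArg natDegree (Chebyshev.C_comp_two_mul_X R N)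
  rwa [natDegree_comp, ← C_ofNat, natDegree_C_mul_X _ two_ne_zero, mul_one,
    natDegree_C_mul two_ne_zero, Chebyshev.natDegree_T, Int.natAbs_natCast] at h

lemma monic_chebyshev_C {N : ℕ} (hN : 0 < N) : (Chebyshev.C R N).Monic := by
  have h := congrArg leadingCoeff (Chebyshev.C_comp_two_mul_X R N)
  rw [← C_ofNat, leadingCoeff_comp (by simp [two_ne_zero]), leadingCoeff_mul_X, leadingCoeff_C,
    natDegree_chebyshev_C, leadingCoeff_mul, leadingCoeff_C, Chebyshev.leadingCoeff_T,
    Int.natAbs_natCast, mul_pow_sub_one hN.ne'] at h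
  exact mul_right_cancel₀ (pow_ne_zero N two_ne_zero) (h.trans (one_mul _).symm)

end ChebyshevDegree

section ChebBlockDegree

open Polynomial

lemma chebBlock_succ (N a : ℕ) :
    chebBlock N (a + 1) = (Chebyshev.S ℤ a).comp ((Chebyshev.C ℤ N).comp (X - C 2)) := by
  simp [chebBlock]

lemma natDegree_chebBlock_succ (N a : ℕ) : (chebBlock N (a + 1)).natDegree = N * a := by
  rw [chebBlock_succ, natDegree_comp, natDegree_comp, natDegree_chebyshev_S,
    natDegree_chebyshev_C, natDegree_X_sub_C, mul_one, mul_comm]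

lemma monic_chebBlock_succ {N : ℕ} (hN : 0 < N) (a : ℕ) : (chebBlock N (a + 1)).Monic := by
  have hlin : ((Chebyshev.C ℤ N).comp (X - C 2)).Monic :=
    (monic_chebyshev_C ℤ hN).comp (monic_X_sub_C 2) <| by
      rw [natDegree_X_sub_C]
      exact one_ne_zero
  rw [chebBlock_succ]
  refine (monic_chebyshev_S ℤ a).comp hlin ?_
  rw [natDegree_comp, natDegree_chebyshev_C, natDegree_X_sub_C, mul_one]
  exact hN.ne'

lemma coeff_chebBlock_succ {N : ℕ} (hN : 0 < N) (a : ℕ) :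
    (chebBlock N (a + 1)).coeff (N * a) = 1 := by
  rw [← natDegree_chebBlock_succ N a, (monic_chebBlock_succ hN a).coeff_natDegree]

lemma coeff_chebBlock_of_lt {N a m : ℕ} (hm : N * a < m + N) : (chebBlock N a).coeff m = 0 := by
  obtain _ | a := a
  · rw [chebBlock_zero, coeff_zero]
  · refine coeff_eq_zero_of_natDegree_lt ?_
    rw [natDegree_chebBlock_succ]
    linarith [mul_add_one N a]

end ChebBlockDegree

section BinomSumHankel

open Polynomial

lemma binomSumHankel_apply (k n : ℕ) (i j : Fin n) :
    binomSumHankel k n i j = centralFunctional (k + 1) (X ^ (i + j + 1 : ℕ)) := by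
  rw [centralFunctional_X_pow_eq_sum, binomSumHankel, Matrix.of_apply]
  push_cast
  rw [sub_add_cancel_right]
  refine Finset.sum_congr rfl fun l _ => ?_
  congr 1 <;> ring

lemma det_binomSumHankel_eq_hankelDet (k n : ℕ) :
    (binomSumHankel k n).det = hankelDet (fun m => centralFunctional (k + 1) (X ^ (m + 1))) n := by
  congr 1
  ext i j
  exact binomSumHankel_apply k n i j

lemma coeff_pow_mul_det_binomSumHankel (k : ℕ) {Q : ℤ[X]} {n g : ℕ} (hdeg : Q.natDegree ≤ n + 1)
    (hzero : Q.coeff 0 = 0) (hQ : ∀ m, m + 1 < n + g → centralFunctional (k + 1) (X ^ m * Q) = 0) :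
    Q.coeff (n + 1) ^ g * (binomSumHankel k (n + g)).det
      = (-1) ^ g.choose 2 * centralFunctional (k + 1) (X ^ (n + g - 1) * Q) ^ g
        * (binomSumHankel k n).det := by
  obtain ⟨P, rfl⟩ := X_dvd_iff.2 hzero
  have hP : P.natDegree ≤ n := by
    rw [natDegree_le_iff_coeff_eq_zero] at hdeg ⊢
    intro m hm
    rw [← coeff_X_mul]
    exact hdeg _ (by omega)
  have hgap := coeff_pow_mul_hankelDet_add
    (centralFunctional (k + 1) ∘ₗ LinearMap.mulLeft ℤ X) P hP (g := g)
  simp only [LinearMap.comp_apply, LinearMap.mulLeft_apply, ← pow_succ', mul_left_comm X] at hgap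
  simpa only [det_binomSumHankel_eq_hankelDet, coeff_X_mul] using hgap hQ

/-- The absolute value of the determinant of size `(k + 1) * q`, in a form which treats the two
parities of `k` at once. -/
def parityFactor (k q : ℕ) : ℤ := q + 1 + (-1) ^ k * q

lemma parityFactor_of_even {k : ℕ} (hk : Even k) (q : ℕ) : parityFactor k q = 2 * q + 1 := by
  rw [parityFactor, hk.neg_one_pow]
  ring

lemma parityFactor_of_odd {k : ℕ} (hk : Odd k) (q : ℕ) : parityFactor k q = 1 := by
  rw [parityFactor, hk.neg_one_pow]
  ring

lemma parityFactor_ne_zero (k q : ℕ) : parityFactor k q ≠ 0 := by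
  obtain hk | hk := k.even_or_odd
  · rw [parityFactor_of_even hk]
    positivity
  · rw [parityFactor_of_odd hk]
    exact one_ne_zero

/-- `X` times a scalar multiple of the orthogonal polynomial of degree `(k + 1) * q` of the
functional `p ↦ centralFunctional (k + 1) (X * p)`. -/
noncomputable def startPoly (k q : ℕ) : ℤ[X] :=
  parityFactor k q • (X * chebBlock (k + 1) (q + 1))
    - (4 * (-1) ^ k * q : ℤ) • chebBlock (k + 1) (q + 1) - (4 * (q + 1) : ℤ) • chebBlock (k + 1) q

lemma coeff_zero_startPoly (k q : ℕ) : (startPoly k q).coeff 0 = 0 := by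
  simp only [startPoly, coeff_sub, coeff_smul, mul_coeff_zero, coeff_X_zero, coeff_zero_chebBlock]
  push_cast
  simp only [smul_eq_mul, pow_mul, pow_succ]
  linear_combination
    (-4 * q * (q + 1) * (-1) ^ k * ((-1) ^ k) ^ q * (-1) ^ q : ℤ) * neg_one_pow_sq k

lemma coeff_succ_startPoly {k q m : ℕ} (hm : (k + 1) * q ≤ m) :
    (startPoly k q).coeff (m + 1) = parityFactor k q * (chebBlock (k + 1) (q + 1)).coeff m := by
  simp only [startPoly, coeff_sub, coeff_smul, coeff_X_mul, smul_eq_mul]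
  rw [coeff_chebBlock_of_lt (m := m + 1) (by rw [mul_add_one]; omega),
    coeff_chebBlock_of_lt (m := m + 1) (by omega)]
  ring

lemma natDegree_startPoly_le (k q : ℕ) : (startPoly k q).natDegree ≤ (k + 1) * q + 1 := by
  rw [natDegree_le_iff_coeff_eq_zero]
  rintro (_ | m) hm
  · omega
  · rw [coeff_succ_startPoly (by omega), coeff_chebBlock_of_lt (by rw [mul_add_one]; omega),
      mul_zero]

lemma centralFunctional_X_pow_mul_startPoly {k q m : ℕ} (hm : m ≤ (k + 1) * q) :
    centralFunctional (k + 1) (X ^ m * startPoly k q)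
      = if m = (k + 1) * q then 4 * (q + 1) - if k = 0 then parityFactor k q else 0 else 0 := by
  have hne : m ≠ (k + 1) * (q + 1) := by
    rw [mul_add_one]
    omega
  have hnext : m + 1 = (k + 1) * (q + 1) ↔ m = (k + 1) * q ∧ k = 0 := by
    rw [mul_add_one]
    omega
  simp only [startPoly, mul_sub, mul_smul_comm, map_sub, map_smul, ← mul_assoc, ← pow_succ,
    smul_eq_mul]
  rw [centralFunctional_X_pow_mul_chebBlock (by rw [mul_add_one]; omega),
    centralFunctional_X_pow_mul_chebBlock (by rw [mul_add_one]; omega),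
    centralFunctional_X_pow_mul_chebBlock hm, if_neg hne]
  simp only [hnext, parityFactor, pow_succ]
  split_ifs <;> first | omega | ring

lemma parityFactor_mul_det_binomSumHankel_add_one (k q : ℕ) :
    parityFactor k q * (binomSumHankel k ((k + 1) * q + 1)).det
      = (4 * (q + 1) - if k = 0 then parityFactor k q else 0)
        * (binomSumHankel k ((k + 1) * q)).det := by
  have hgap := coeff_pow_mul_det_binomSumHankel k (n := (k + 1) * q) (g := 1)
    (natDegree_startPoly_le k q) (coeff_zero_startPoly k q) fun m hm => by
      rw [centralFunctional_X_pow_mul_startPoly (by omega), if_neg (by omega)]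
  rw [coeff_succ_startPoly le_rfl, coeff_chebBlock_succ k.add_one_pos, Nat.add_sub_cancel,
    centralFunctional_X_pow_mul_startPoly le_rfl, if_pos rfl] at hgap
  simpa using hgap

/-- `X` times a scalar multiple of the orthogonal polynomial of degree `(k + 1) * q + k` of the
functional `p ↦ centralFunctional (k + 1) (X * p)`. -/
noncomputable def endPoly (k q : ℕ) : ℤ[X] :=
  (4 * (q + 1) : ℤ) • chebBlock (k + 1) (q + 2)
    + (4 * (-1) ^ k * (q + 2) : ℤ) • chebBlock (k + 1) (q + 1)
    - ((-1) ^ k * parityFactor k (q + 1)) • (X * chebBlock (k + 1) (q + 1))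

lemma coeff_zero_endPoly (k q : ℕ) : (endPoly k q).coeff 0 = 0 := by
  simp only [endPoly, coeff_sub, coeff_add, coeff_smul, mul_coeff_zero, coeff_X_zero,
    coeff_zero_chebBlock]
  push_cast
  simp only [smul_eq_mul, pow_mul, pow_succ]
  ring

lemma coeff_endPoly_of_le {k q m : ℕ} (hk : k ≠ 0) (hm : (k + 1) * (q + 1) ≤ m) :
    (endPoly k q).coeff m = 4 * (q + 1) * (chebBlock (k + 1) (q + 2)).coeff m := by
  rw [mul_add_one] at hm
  obtain _ | m := m
  · omega
  · simp only [endPoly, coeff_sub, coeff_add, coeff_smul, coeff_X_mul, smul_eq_mul]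
    rw [coeff_chebBlock_of_lt (a := q + 1) (m := m + 1) (by rw [mul_add_one]; omega),
      coeff_chebBlock_of_lt (a := q + 1) (m := m) (by rw [mul_add_one]; omega)]
    ring

lemma natDegree_endPoly_le {k : ℕ} (hk : k ≠ 0) (q : ℕ) :
    (endPoly k q).natDegree ≤ (k + 1) * (q + 1) := by
  rw [natDegree_le_iff_coeff_eq_zero]
  intro m hm
  rw [coeff_endPoly_of_le hk hm.le, coeff_chebBlock_of_lt (by linarith), mul_zero]

lemma centralFunctional_X_pow_mul_endPoly {k q m : ℕ} (hm : m + 1 ≤ (k + 1) * (q + 1)) :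
    centralFunctional (k + 1) (X ^ m * endPoly k q)
      = if m + 1 = (k + 1) * (q + 1) then (-1) ^ k * parityFactor k (q + 1) else 0 := by
  have hlt : m < (k + 1) * (q + 2) := by linarith
  simp only [endPoly, mul_sub, mul_add (X ^ m), mul_smul_comm, map_sub, map_add, map_smul,
    ← mul_assoc, ← pow_succ, smul_eq_mul]
  rw [centralFunctional_X_pow_mul_chebBlock hlt.le, centralFunctional_X_pow_mul_chebBlock hm,
    centralFunctional_X_pow_mul_chebBlock (by omega), if_neg hlt.ne, if_neg (by omega)]
  simp only [parityFactor, pow_succ]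
  push_cast
  split_ifs <;> linear_combination (-4 * (q + 1) * 4 ^ m : ℤ) * neg_one_pow_sq k

lemma mul_det_binomSumHankel_add_self {k : ℕ} (hk : k ≠ 0) (q : ℕ) :
    4 * (q + 1) * (binomSumHankel k ((k + 1) * (q + 1))).det
      = (-1) ^ k * parityFactor k (q + 1) * (binomSumHankel k ((k + 1) * q + k)).det := by
  have hsize : (k + 1) * (q + 1) = (k + 1) * q + k + 1 := by ring
  have hgap := coeff_pow_mul_det_binomSumHankel k (n := (k + 1) * q + k) (g := 1)
    (hsize ▸ natDegree_endPoly_le hk q) (coeff_zero_endPoly k q) fun m hm => by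
      rw [centralFunctional_X_pow_mul_endPoly (by omega), if_neg (by omega)]
  rw [Nat.add_sub_cancel, ← hsize, coeff_endPoly_of_le hk le_rfl,
    coeff_chebBlock_succ k.add_one_pos, centralFunctional_X_pow_mul_endPoly hsize.ge,
    if_pos hsize.symm] at hgap
  simpa using hgap

/-- For `2 ≤ k`, `X` times the monic orthogonal polynomial of degree `(k + 1) * q + 1` of the
functional `p ↦ centralFunctional (k + 1) (X * p)`. -/
noncomputable def gapPoly (k q : ℕ) : ℤ[X] := X * ((X - C 4) * chebBlock (k + 1) (q + 1))

lemma coeff_zero_gapPoly (k q : ℕ) : (gapPoly k q).coeff 0 = 0 := coeff_X_mul_zero _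

lemma monic_gapPoly (k q : ℕ) : (gapPoly k q).Monic :=
  monic_X.mul ((monic_X_sub_C 4).mul (monic_chebBlock_succ k.add_one_pos q))

lemma natDegree_gapPoly (k q : ℕ) : (gapPoly k q).natDegree = (k + 1) * q + 1 + 1 := by
  have hblock := monic_chebBlock_succ k.add_one_pos q
  rw [gapPoly, monic_X.natDegree_mul ((monic_X_sub_C 4).mul hblock),
    (monic_X_sub_C 4).natDegree_mul hblock, natDegree_X, natDegree_X_sub_C,
    natDegree_chebBlock_succ]
  ring

lemma centralFunctional_X_pow_mul_gapPoly {k q m : ℕ} (hm : m + 1 ≤ (k + 1) * q + k) :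
    centralFunctional (k + 1) (X ^ m * gapPoly k q)
      = if m + 1 = (k + 1) * q + k then -1 else 0 := by
  have hsize : (k + 1) * (q + 1) = (k + 1) * q + k + 1 := by ring
  have hnext : m + 2 = (k + 1) * q + k + 1 ↔ m + 1 = (k + 1) * q + k := by omega
  have hexpand : X ^ m * gapPoly k q = X ^ (m + 2) * chebBlock (k + 1) (q + 1)
      - (4 : ℤ) • (X ^ (m + 1) * chebBlock (k + 1) (q + 1)) := by
    rw [gapPoly, smul_eq_C_mul]
    ring
  rw [hexpand, map_sub, map_smul, smul_eq_mul, centralFunctional_X_pow_mul_chebBlock (by omega),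
    centralFunctional_X_pow_mul_chebBlock (by omega), hsize]
  simp only [hnext]
  rw [if_neg (show m + 1 ≠ (k + 1) * q + k + 1 by omega)]
  split_ifs <;> ring

lemma det_binomSumHankel_add_one_add {k s : ℕ} (hs : s < k) (q : ℕ) :
    (binomSumHankel k ((k + 1) * q + 1 + s)).det
      = (-1) ^ s.choose 2 * (if s + 1 = k then -1 else 0) ^ s
        * (binomSumHankel k ((k + 1) * q + 1)).det := by
  have hlead : (gapPoly k q).coeff ((k + 1) * q + 1 + 1) = 1 := by
    rw [← natDegree_gapPoly, (monic_gapPoly k q).coeff_natDegree]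
  have hgap := coeff_pow_mul_det_binomSumHankel k (g := s) (natDegree_gapPoly k q).le
    (coeff_zero_gapPoly k q) fun m hm => by
      rw [centralFunctional_X_pow_mul_gapPoly (by omega), if_neg (by omega)]
  have hiff : (k + 1) * q + 1 + s - 1 + 1 = (k + 1) * q + k ↔ s + 1 = k := by omega
  rw [hlead, one_pow, one_mul, centralFunctional_X_pow_mul_gapPoly (by omega)] at hgap
  simpa only [hiff] using hgap

lemma det_binomSumHankel_eq_zero {k s : ℕ} (hs : s ≠ 0) (hsk : s + 1 < k) (q : ℕ) :
    (binomSumHankel k ((k + 1) * q + 1 + s)).det = 0 := by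
  rw [det_binomSumHankel_add_one_add (by omega), if_neg hsk.ne, zero_pow hs, mul_zero, zero_mul]

lemma det_binomSumHankel_add_self {k : ℕ} (hk : k ≠ 0) (q : ℕ) :
    (binomSumHankel k ((k + 1) * q + k)).det
      = (-1) ^ k.choose 2 * (binomSumHankel k ((k + 1) * q + 1)).det := by
  obtain ⟨s, rfl⟩ := Nat.exists_eq_add_one_of_ne_zero hk
  have hsize : (s + 1 + 1) * q + (s + 1) = (s + 1 + 1) * q + 1 + s := by ring
  rw [hsize, det_binomSumHankel_add_one_add s.lt_add_one, if_pos rfl, ← pow_add,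
    Nat.choose_succ_succ' s 1, Nat.choose_one_right, add_comm (s.choose 2)]

lemma parityFactor_mul_det_binomSumHankel_succ (k q : ℕ) :
    parityFactor k q * (binomSumHankel k ((k + 1) * (q + 1))).det
      = (-1) ^ (k + 1).choose 2 * parityFactor k (q + 1)
        * (binomSumHankel k ((k + 1) * q)).det := by
  have hstart := parityFactor_mul_det_binomSumHankel_add_one k q
  obtain rfl | hk := eq_or_ne k 0
  · simp only [parityFactor, zero_add, one_mul, pow_zero, if_true] at hstart ⊢
    push_cast
    simp only [Nat.choose_eq_zero_of_lt one_lt_two, pow_zero]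
    linear_combination hstart
  · have hend := mul_det_binomSumHankel_add_self hk q
    rw [det_binomSumHankel_add_self hk] at hend
    rw [if_neg hk, sub_zero] at hstart
    rw [Nat.choose_succ_succ' k 1, Nat.choose_one_right, pow_add]
    have hpos : (4 * (q + 1) : ℤ) ≠ 0 := by positivity
    apply mul_left_cancel₀ hpos
    linear_combination parityFactor k q * hend
      + (-1) ^ k * parityFactor k (q + 1) * (-1) ^ k.choose 2 * hstart

lemma det_binomSumHankel_mul (k q : ℕ) :
    (binomSumHankel k ((k + 1) * q)).det = (-1) ^ (q * (k + 1).choose 2) * parityFactor k q := by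
  induction q with
  | zero => simp [parityFactor]
  | succ q ih =>
    apply mul_left_cancel₀ (parityFactor_ne_zero k q)
    rw [parityFactor_mul_det_binomSumHankel_succ, ih, add_one_mul, pow_add]
    ring

lemma det_binomSumHankel_mul_add_one {k : ℕ} (hk : k ≠ 0) (q : ℕ) :
    (binomSumHankel k ((k + 1) * q + 1)).det
      = (-1) ^ (q * (k + 1).choose 2) * (4 * q + 4) := by
  apply mul_left_cancel₀ (parityFactor_ne_zero k q)
  rw [parityFactor_mul_det_binomSumHankel_add_one, if_neg hk, det_binomSumHankel_mul]
  ring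

lemma det_binomSumHankel_mul_add_self {k : ℕ} (hk : k ≠ 0) (q : ℕ) :
    (binomSumHankel k ((k + 1) * q + k)).det
      = (-1) ^ ((q + 1) * (k + 1).choose 2 + k) * (4 * q + 4) := by
  rw [det_binomSumHankel_add_self hk, det_binomSumHankel_mul_add_one hk, add_one_mul,
    Nat.choose_succ_succ' k 1, Nat.choose_one_right]
  simp only [pow_add]
  linear_combination
    (-(-1) ^ k.choose 2 * (-1) ^ (q * (k + k.choose 2)) * (4 * q + 4) : ℤ) * neg_one_pow_sq k

end BinomSumHankel

theorem corollary18 (n k : ℕ) (hn : 0 < n) :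
    (∀ n₁ : ℕ, n = (k + 1) * n₁ → Even k →
      (binomSumHankel k n).det = (-1) ^ (n₁ * (k + 1).choose 2) * (2 * (n₁ : ℤ) + 1)) ∧
    (∀ n₁ : ℕ, n = (k + 1) * n₁ → Odd k →
      (binomSumHankel k n).det = (-1) ^ (n₁ * (k + 1).choose 2)) ∧
    (∀ n₁ : ℕ, k ≠ 0 → n = (k + 1) * n₁ + 1 →
      (binomSumHankel k n).det = (-1) ^ (n₁ * (k + 1).choose 2) * (4 * (n₁ : ℤ) + 4)) ∧
    (∀ n₁ : ℕ, k ≠ 0 → n = (k + 1) * n₁ + k →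
      (binomSumHankel k n).det =
        (-1) ^ ((n₁ + 1) * (k + 1).choose 2 + k) * (4 * (n₁ : ℤ) + 4)) ∧
    (¬ n ≡ 0 [MOD k + 1] → ¬ n ≡ 1 [MOD k + 1] → ¬ n ≡ k [MOD k + 1] →
      (binomSumHankel k n).det = 0) := by
  refine ⟨?_, ?_, ?_, ?_, fun h0 h1 hk => ?_⟩
  · rintro q rfl heven
    rw [det_binomSumHankel_mul, parityFactor_of_even heven]
  · rintro q rfl hodd
    rw [det_binomSumHankel_mul, parityFactor_of_odd hodd, mul_one]
  · rintro q hk rfl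
    exact det_binomSumHankel_mul_add_one hk q
  · rintro q hk rfl
    exact det_binomSumHankel_mul_add_self hk q
  · have hlt : n % (k + 1) < k + 1 := n.mod_lt k.add_one_pos
    have hne0 : n % (k + 1) ≠ 0 := h0
    have hnek : n % (k + 1) ≠ k := fun h => hk (h.trans (Nat.mod_eq_of_lt k.lt_succ_self).symm)
    have hne1 : n % (k + 1) ≠ 1 := fun h => h1 (h.trans (Nat.mod_eq_of_lt (by omega)).symm)
    have hsplit : (k + 1) * (n / (k + 1)) + 1 + (n % (k + 1) - 1) = n := by
      have := n.div_add_mod (k + 1)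
      omega
    rw [← hsplit]
    exact det_binomSumHankel_eq_zero (by omega) (by omega) _
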